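/- Let $\mathbb F_q$ be a finite field, $R=\mathbb F_q[T]$, $k=\mathbb F_q(T)$, and let $n\ge 1$ be an integer. Let $D\in R$ be a square-free polynomial of one of the following forms. First group. Here $Z\in R$ is any non-constant polynomial and $F\in R$. (1) $D=Z^{2n}+1$; (2) $D=(Z^n+F-1)^2+4F$ with $F\mid Z^n-1$; (3) $D=(Z^n-F+1)^2+4F$ with $F\mid Z^n+1$; (4) $D=(4Z^n+F-1)^2+4F$ with $F\mid 4Z^n-1$; (5) in general, $D=(Z^n+aF-b)^2+4abF$ with $a,b\in\mathbb F_q^\times$ and $F\mid Z^n-b$; where in (2)–(5) the polynomial in parentheses, whose square is taken, is required to be non-constant. Second group. Here $a\in R$ is a non-constant polynomial such that $A=2a+1$ is monic and $A=Z^n$ for some non-constant $Z\in R$, and $d\ge 1$ is an integer. (6) $D=(A^d+a)^2+A$; (7) $D=(A^d-a)^2+A$; (8) $D=(A^d+a+1)^2-A$; (9) $D=(A^d-a-1)^2-A$; where in (6) and (8) the polynomial in parentheses is required to be non-constant (this excludes only $d=1$ in characteristic $3$). Let $K=k(\sqrt D)$, let $\mathcal O_K$ be the integral closure of $R$ in $K$,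 and let $h(D)$ be the ideal class number of $K$, i.e. the order of the group of fractional ideals of $\mathcal O_K$ modulo principal ideals. Then $h(D)$ is finite and $n$ divides $h(D)$. In particular $h(D)\ge n$. -/

import Mathlib

open scoped Polynomial

/-- The ideal class number `h(K)`: the number of elements of the ideal class group (fractional
ideals modulo principal ones) of the integral closure of `Fq[T]` in `K`. It has the junk value `0`
if that group is infinite, so finiteness has to be stated along with it. -/
noncomputable def idealClassNumber (Fq K : Type*) [Field Fq] [Field K] [Algebra Fq[X] K] : ℕ :=
  Nat.card (ClassGroup (FunctionField.ringOfIntegers Fq K))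

/-- `K = k(√D)`, where `k = Fq(T)`: the field `K` is generated over `k` by a square root of `D`. -/
def IsAdjoinSqrt (Fq K : Type*) [Field Fq] [Field K] [Algebra Fq[X] K] [Algebra (RatFunc Fq) K]
    (D : Fq[X]) : Prop :=
  ∃ s : K, s ^ 2 = algebraMap Fq[X] K D ∧ IntermediateField.adjoin (RatFunc Fq) {s} = ⊤

/-- The first group of series: `D = N ^ 2 + r` with `r ∣ 4 N`, where `N` is not constant. -/
inductive FirstFamily {Fq : Type*} [Field Fq] (n : ℕ) : Fq[X] → Prop
  | series1 (Z : Fq[X]) (hZ : 0 < Z.natDegree) :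
      FirstFamily n (Z ^ (2 * n) + 1)
  | series2 (Z F : Fq[X]) (hZ : 0 < Z.natDegree) (hF : F ∣ Z ^ n - 1)
      (hN : 0 < (Z ^ n + F - 1).natDegree) :
      FirstFamily n ((Z ^ n + F - 1) ^ 2 + 4 * F)
  | series3 (Z F : Fq[X]) (hZ : 0 < Z.natDegree) (hF : F ∣ Z ^ n + 1)
      (hN : 0 < (Z ^ n - F + 1).natDegree) :
      FirstFamily n ((Z ^ n - F + 1) ^ 2 + 4 * F)
  | series4 (Z F : Fq[X]) (hZ : 0 < Z.natDegree) (hF : F ∣ 4 * Z ^ n - 1)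
      (hN : 0 < (4 * Z ^ n + F - 1).natDegree) :
      FirstFamily n ((4 * Z ^ n + F - 1) ^ 2 + 4 * F)
  | general (Z F : Fq[X]) (a b : Fq) (hZ : 0 < Z.natDegree) (ha : a ≠ 0) (hb : b ≠ 0)
      (hF : F ∣ Z ^ n - Polynomial.C b)
      (hN : 0 < (Z ^ n + Polynomial.C a * F - Polynomial.C b).natDegree) :
      FirstFamily n ((Z ^ n + Polynomial.C a * F - Polynomial.C b) ^ 2
        + 4 * Polynomial.C a * Polynomial.C b * F)

/-- The data of the second group of series: `a` is not constant, and `A = 2 a + 1` is monic and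
the `n`-th power of a polynomial `Z` that is not constant. -/
structure SecondData {Fq : Type*} [Field Fq] (n : ℕ) (a A Z : Fq[X]) : Prop where
  a_nonconst : 0 < a.natDegree
  A_eq : A = 2 * a + 1
  A_monic : A.Monic
  Z_nonconst : 0 < Z.natDegree
  A_eq_pow : A = Z ^ n

/-- The second group of series. The polynomial that is squared is again required not to be constant
where this is not automatic (it fails only for `d = 1` in characteristic `3`). -/
inductive SecondFamily {Fq : Type*} [Field Fq] (n : ℕ) : Fq[X] → Prop
  | series1 (a A Z : Fq[X]) (d : ℕ) (h : SecondData n a A Z) (hd : 1 ≤ d)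
      (hN : 0 < (A ^ d + a).natDegree) :
      SecondFamily n ((A ^ d + a) ^ 2 + A)
  | series2 (a A Z : Fq[X]) (d : ℕ) (h : SecondData n a A Z) (hd : 1 ≤ d) :
      SecondFamily n ((A ^ d - a) ^ 2 + A)
  | series3 (a A Z : Fq[X]) (d : ℕ) (h : SecondData n a A Z) (hd : 1 ≤ d)
      (hN : 0 < (A ^ d + a + 1).natDegree) :
      SecondFamily n ((A ^ d + a + 1) ^ 2 - A)
  | series4 (a A Z : Fq[X]) (d : ℕ) (h : SecondData n a A Z) (hd : 1 ≤ d) :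
      SecondFamily n ((A ^ d - a - 1) ^ 2 - A)

open scoped Polynomial

/-! Every `D` here equals `U ^ 2 - c Z ^ M` with `c` a nonzero constant and `M = n` or `M = 2 n`. In
`F[T][√D]` the element `x = U + √D` has norm `c Z ^ M` and, for `n ≥ 2`, is coprime to its
conjugate, so `(x) = I ^ M` for an ideal `I`. If the class of `I` has order `m` and `M = m l`, then
`x` is associated to some `w ^ l`, and the norm of `w` has degree `m deg Z`. Suppose `m < n`. The
heart of the proof is that an element with norm of degree below `n deg Z` is associated to its
conjugate; then so is `x`, which by coprimality becomes a unit, a contradiction. Hence `m ≥ n`, and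
`m ∣ M` forces `n ∣ m` (`HasPowerNorm.dvd_card`).

The statement on small norms takes the place of the continued fraction of `√D`. Elements much larger
than their conjugate at infinity satisfy a best approximation property (`IsDominant.re_mul_im_eq`),
and multiplication by an explicit unit reduces to elements of small `√D`-coefficient
(`associated_star_of_natDegree_norm_lt`). Below the unit, the first group leaves only multiples of
`N + √D` (`associated_star_of_dvd_two_mul`), the second nothing at all
(`associated_star_of_natDegree_norm_lt_natDegree`). -/

theorem ClassGroup.exists_dvd_card_of_mul_associated_pow {O : Type*} [CommRing O]
    [IsDedekindDomain O] {x y z : O} {M : ℕ} (hM : M ≠ 0) (hx : x ≠ 0) (hxy : IsCoprime x y)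
    (h : Associated (x * y) (z ^ M)) :
    ∃ m l : ℕ, m * l = M ∧ m ∣ Nat.card (ClassGroup O) ∧ ∃ w : O, Associated (w ^ l) x := by
  classical
  have hI : Ideal.span {x} * Ideal.span {y} = Ideal.span {z} ^ M := by
    rw [Ideal.span_singleton_mul_span_singleton, Ideal.span_singleton_pow,
      Ideal.span_singleton_eq_span_singleton]
    exact h
  have hcop : IsUnit (gcd (Ideal.span {x}) (Ideal.span {y})) := by
    have : IsCoprime (Ideal.span {x}) (Ideal.span {y}) := by
      rwa [Ideal.isCoprime_span_singleton_iff]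
    rw [Ideal.isCoprime_iff_sup_eq] at this
    refine isUnit_of_dvd_one ?_
    rw [Ideal.one_eq_top, ← this]
    exact Ideal.dvd_iff_le.mpr (sup_le (Ideal.dvd_iff_le.mp (gcd_dvd_left _ _))
      (Ideal.dvd_iff_le.mp (gcd_dvd_right _ _)))
  -- Ideals have only the trivial unit, so a factor coprime to its cofactor in an `M`-th power is
  -- exactly an `M`-th power.
  obtain ⟨I, hIx⟩ := exists_eq_pow_of_mul_eq_pow hcop hI
  have hI0 : I ≠ 0 := by
    rintro rfl
    rw [zero_pow hM] at hIx
    exact hx (Ideal.span_singleton_eq_bot.mp hIx)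
  set J : nonZeroDivisors (Ideal O) := ⟨I, mem_nonZeroDivisors_of_ne_zero hI0⟩ with hJ
  set g := ClassGroup.mk0 J with hg
  have key : ∀ k : ℕ, g ^ k = 1 ↔ (I ^ k).IsPrincipal := by
    intro k
    rw [hg, ← map_pow]
    exact ClassGroup.mk0_eq_one_iff (J ^ k).2
  have hgM : g ^ M = 1 := (key M).mpr ⟨⟨x, hIx.symm⟩⟩
  obtain ⟨l, hl⟩ := orderOf_dvd_of_pow_eq_one hgM
  refine ⟨orderOf g, l, hl.symm, orderOf_dvd_natCard g, ?_⟩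
  obtain ⟨⟨w, hw⟩⟩ := (key _).mp (pow_orderOf_eq_one g)
  refine ⟨w, ?_⟩
  rw [← Ideal.span_singleton_eq_span_singleton, hIx, hl, pow_mul, ← Ideal.span_singleton_pow]
  exact congrArg (· ^ l) hw.symm

/-! ### Approximation of `√D` at infinity and descent by a unit. -/

namespace QuadraticAlgebra

variable {F : Type*} [Field F] {N D : F[X]}

theorem _root_.Polynomial.degree_lt_cast_of_natDegree_lt {p : F[X]} {k : ℕ} (h : p.natDegree < k) :
    p.degree < k :=
  p.degree_le_natDegree.trans_lt (Nat.cast_lt.mpr h)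

theorem _root_.Polynomial.degree_mul_lt_add {p q : F[X]} {a b : ℕ} (hp : p.degree < a) (hq : q.natDegree ≤ b) :
    (p * q).degree < (a + b : ℕ) := by
  rcases eq_or_ne p 0 with rfl | hp0
  · simp
  · refine Polynomial.degree_lt_cast_of_natDegree_lt (Polynomial.natDegree_mul_le.trans_lt ?_)
    have := (Polynomial.natDegree_lt_iff_degree_lt hp0).mpr hp
    omega

theorem _root_.Polynomial.degree_lt_of_degree_mul_lt {p q : F[X]} {a : ℕ} (hq : q ≠ 0)
    (h : (p * q).degree < (a + q.natDegree : ℕ)) : p.degree < a := by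
  rcases eq_or_ne p 0 with rfl | hp0
  · simp
  · rw [← Polynomial.natDegree_lt_iff_degree_lt (mul_ne_zero hp0 hq), Polynomial.natDegree_mul hp0 hq] at h
    exact (Polynomial.natDegree_lt_iff_degree_lt hp0).mp (by omega)

theorem norm_eq_sq_sub (z : QuadraticAlgebra F[X] D 0) : z.norm = z.re ^ 2 - D * z.im ^ 2 := by
  rw [norm_def]; ring

/-- For `N` close to `√D` at the infinite place: `z.re + z.im √D` is as large as `2 N z.im`,
with its conjugate strictly smaller. -/
def IsDominant (N : F[X]) (z : QuadraticAlgebra F[X] D 0) : Prop :=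
  z.im ≠ 0 ∧ (z.re - N * z.im).degree < (N.natDegree + z.im.natDegree : ℕ)

/-- Since `re ≈ N im` for both elements, the two products add up to `2 N z.im w.im` plus lower
terms; characteristic 2 would cancel this leading term. -/
theorem IsDominant.cross (h2 : (2 : F) ≠ 0) (hN : 0 < N.natDegree) {z w : QuadraticAlgebra F[X] D 0}
    (hz : IsDominant N z) (hw : IsDominant N w) :
    z.re * w.im + z.im * w.re ≠ 0 ∧ (z.re * w.im + z.im * w.re).natDegree =
      N.natDegree + z.im.natDegree + w.im.natDegree := by
  have hN0 : N ≠ 0 := Polynomial.ne_zero_of_natDegree_gt hN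
  have hm0 : N * z.im * w.im ≠ 0 := mul_ne_zero (mul_ne_zero hN0 hz.1) hw.1
  have hmain : (Polynomial.C 2 * (N * z.im * w.im)).degree =
      ((N.natDegree + z.im.natDegree + w.im.natDegree : ℕ) : WithBot ℕ) := by
    rw [Polynomial.degree_C_mul h2, Polynomial.degree_eq_natDegree hm0,
      Polynomial.natDegree_mul (mul_ne_zero hN0 hz.1) hw.1, Polynomial.natDegree_mul hN0 hz.1]
  have h1 := Polynomial.degree_mul_lt_add hz.2 (le_refl w.im.natDegree)
  have h3 := Polynomial.degree_mul_lt_add hw.2 (le_refl z.im.natDegree)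
  have hlt : ((z.re - N * z.im) * w.im + (w.re - N * w.im) * z.im).degree <
      (Polynomial.C 2 * (N * z.im * w.im)).degree := by
    rw [hmain]
    refine (Polynomial.degree_add_le _ _).trans_lt (max_lt h1 ?_)
    convert h3 using 2
    omega
  have hsum : z.re * w.im + z.im * w.re = Polynomial.C 2 * (N * z.im * w.im) +
      ((z.re - N * z.im) * w.im + (w.re - N * w.im) * z.im) := by
    rw [Polynomial.C_ofNat]; ring
  have hdeg : (z.re * w.im + z.im * w.re).degree =
      ((N.natDegree + z.im.natDegree + w.im.natDegree : ℕ) : WithBot ℕ) := by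
    rw [hsum, Polynomial.degree_add_eq_left_of_degree_lt hlt, hmain]
  refine ⟨fun h0 => ?_, Polynomial.natDegree_eq_of_degree_eq_some hdeg⟩
  rw [h0, Polynomial.degree_zero] at hdeg
  exact WithBot.bot_ne_coe hdeg

theorem IsDominant.natDegree_im_mul (h2 : (2 : F) ≠ 0) (hN : 0 < N.natDegree) {z w : QuadraticAlgebra F[X] D 0}
    (hz : IsDominant N z) (hw : IsDominant N w) :
    (z * w).im.natDegree = N.natDegree + z.im.natDegree + w.im.natDegree := by
  rw [← (hz.cross h2 hN hw).2, im_mul]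
  simp

theorem IsDominant.mul (h2 : (2 : F) ≠ 0) (hN : 0 < N.natDegree)
    (hD : (D - N ^ 2).natDegree < 2 * N.natDegree) {z w : QuadraticAlgebra F[X] D 0}
    (hz : IsDominant N z) (hw : IsDominant N w) : IsDominant N (z * w) := by
  have hdeg := hz.natDegree_im_mul h2 hN hw
  have him : (z * w).im = z.re * w.im + z.im * w.re := by simp [im_mul]
  refine ⟨him ▸ (hz.cross h2 hN hw).1, ?_⟩
  have hre : (z * w).re - N * (z * w).im =
      (z.re - N * z.im) * (w.re - N * w.im) + (D - N ^ 2) * (z.im * w.im) := by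
    rw [him, re_mul]; ring
  rw [hre, hdeg]
  refine (Polynomial.degree_add_le _ _).trans_lt (max_lt ?_ ?_)
  · have hle : (w.re - N * w.im).natDegree ≤ N.natDegree + w.im.natDegree :=
      Polynomial.natDegree_le_of_degree_le hw.2.le
    convert Polynomial.degree_mul_lt_add hz.2 hle using 2
    omega
  · convert Polynomial.degree_mul_lt_add (Polynomial.degree_lt_cast_of_natDegree_lt hD)
      (Polynomial.natDegree_mul_le (p := z.im) (q := w.im)) using 2
    omega

theorem IsDominant.pow_succ (h2 : (2 : F) ≠ 0) (hN : 0 < N.natDegree)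
    (hD : (D - N ^ 2).natDegree < 2 * N.natDegree) {z : QuadraticAlgebra F[X] D 0}
    (hz : IsDominant N z) (j : ℕ) : IsDominant N (z ^ (j + 1)) ∧
      (z ^ (j + 1)).im.natDegree = j * N.natDegree + (j + 1) * z.im.natDegree := by
  induction j with
  | zero => simpa using hz
  | succ j ih =>
    rw [_root_.pow_succ]
    refine ⟨ih.1.mul h2 hN hD hz, ?_⟩
    rw [ih.1.natDegree_im_mul h2 hN hz, ih.2]
    ring

theorem IsDominant.of_smul {c : F[X]} (hc : c ≠ 0) {z : QuadraticAlgebra F[X] D 0}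
    (hz : IsDominant N (c • z)) :
    IsDominant N z ∧ (c • z).im.natDegree = c.natDegree + z.im.natDegree := by
  obtain ⟨h1, h2⟩ := hz
  simp only [im_smul, re_smul, smul_eq_mul] at h1 h2 ⊢
  have him : z.im ≠ 0 := right_ne_zero_of_mul h1
  rw [Polynomial.natDegree_mul hc him] at h2 ⊢
  refine ⟨⟨him, Polynomial.degree_lt_of_degree_mul_lt hc ?_⟩, rfl⟩
  convert h2 using 2
  · ring
  · omega

/-- Multiplied by the sum from `IsDominant.cross`, of known degree, the difference becomes a
combination of the two norms. -/
theorem IsDominant.degree_re_mul_im_sub_lt (h2 : (2 : F) ≠ 0) (hN : 0 < N.natDegree)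
    {z w : QuadraticAlgebra F[X] D 0} (hz : IsDominant N z) (hw : IsDominant N w) {t : ℕ}
    (h : w.im.natDegree + z.norm.natDegree < t + N.natDegree + z.im.natDegree)
    (h' : z.im.natDegree + w.norm.natDegree < t + N.natDegree + w.im.natDegree) :
    (z.re * w.im - z.im * w.re).degree < t := by
  obtain ⟨h0, hdeg⟩ := hz.cross h2 hN hw
  refine Polynomial.degree_lt_of_degree_mul_lt h0 ?_
  rw [hdeg]
  have : (z.re * w.im - z.im * w.re) * (z.re * w.im + z.im * w.re) =
      w.im ^ 2 * z.norm - z.im ^ 2 * w.norm := by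
    rw [norm_eq_sq_sub, norm_eq_sq_sub]; ring
  rw [this]
  refine (Polynomial.degree_sub_le _ _).trans_lt (max_lt ?_ ?_) <;>
  · refine Polynomial.degree_lt_cast_of_natDegree_lt (Polynomial.natDegree_mul_le.trans_lt ?_)
    rw [Polynomial.natDegree_pow]
    omega

/-- The best approximation property of the convergents of `√D`. -/
theorem IsDominant.re_mul_im_eq (h2 : (2 : F) ≠ 0) (hN : 0 < N.natDegree)
    {z w : QuadraticAlgebra F[X] D 0} (hz : IsDominant N z) (hw : IsDominant N w)
    (h : w.im.natDegree + z.norm.natDegree < N.natDegree + z.im.natDegree)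
    (h' : z.im.natDegree + w.norm.natDegree < N.natDegree + w.im.natDegree) :
    z.re * w.im = z.im * w.re := by
  have := hz.degree_re_mul_im_sub_lt h2 hN hw (t := 0) (by omega) (by omega)
  rwa [Nat.cast_zero, Nat.WithBot.lt_zero_iff, Polynomial.degree_eq_bot, sub_eq_zero] at this

/-- By best approximation `z` and `w` are proportional over `F(T)`, so their norms are in the ratio
of the squares of their `√D`-coefficients. -/
theorem IsDominant.natDegree_norm_le (h2 : (2 : F) ≠ 0) (hN : 0 < N.natDegree)
    {z w : QuadraticAlgebra F[X] D 0} (hz : IsDominant N z) (hw : IsDominant N w) (hw0 : w.norm ≠ 0)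
    (hzN : z.norm.natDegree < N.natDegree) (h : w.im.natDegree ≤ z.im.natDegree)
    (h' : z.im.natDegree + w.norm.natDegree < N.natDegree + w.im.natDegree) :
    w.norm.natDegree ≤ z.norm.natDegree := by
  have heq := hz.re_mul_im_eq h2 hN hw (by omega) h'
  have hnorm : z.norm * w.im ^ 2 = z.im ^ 2 * w.norm := by
    rw [norm_eq_sq_sub, norm_eq_sq_sub]
    linear_combination (z.re * w.im + z.im * w.re) * heq
  have hz0 : z.norm ≠ 0 := by
    intro h0
    rw [h0, zero_mul] at hnorm
    exact mul_ne_zero (pow_ne_zero 2 hz.1) hw0 hnorm.symm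
  have := congrArg Polynomial.natDegree hnorm
  rw [Polynomial.natDegree_mul hz0 (pow_ne_zero 2 hw.1), Polynomial.natDegree_mul (pow_ne_zero 2 hz.1) hw0,
    Polynomial.natDegree_pow, Polynomial.natDegree_pow] at this
  omega

/-- The product of `re - N im` and `re + N im` is `norm + (D - N ^ 2) im ^ 2`, of degree too small
for both factors to be large. -/
theorem isDominant_or_isDominant_star
    (hD : (D - N ^ 2).natDegree < 2 * N.natDegree) {z : QuadraticAlgebra F[X] D 0} (hz : z.im ≠ 0)
    (hnorm : z.norm.natDegree < N.natDegree) : IsDominant N z ∨ IsDominant N (star z) := by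
  by_contra! hcon
  obtain ⟨h1, h3⟩ := hcon
  simp only [IsDominant, not_and, not_lt, im_star, re_star, zero_mul, add_zero, neg_ne_zero,
    Polynomial.natDegree_neg] at h1 h3
  specialize h1 hz
  specialize h3 hz
  have hprod : (z.re - N * z.im) * (z.re - N * -z.im) = z.norm + (D - N ^ 2) * z.im ^ 2 := by
    rw [norm_eq_sq_sub]; ring
  have hlt : (z.norm + (D - N ^ 2) * z.im ^ 2).degree <
      (N.natDegree + z.im.natDegree + (N.natDegree + z.im.natDegree) : ℕ) := by
    refine (Polynomial.degree_add_le _ _).trans_lt (max_lt ?_ ?_)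
    · exact Polynomial.degree_lt_cast_of_natDegree_lt (by omega)
    · refine Polynomial.degree_lt_cast_of_natDegree_lt (Polynomial.natDegree_mul_le.trans_lt ?_)
      rw [Polynomial.natDegree_pow]
      omega
  rw [← hprod, Polynomial.degree_mul, Nat.cast_add] at hlt
  exact (add_le_add h1 h3).not_gt hlt

/-- Descent by a dominant unit `u`. -/
theorem associated_star_of_natDegree_norm_lt (h2 : (2 : F) ≠ 0) (hN : 0 < N.natDegree)
    (hD : (D - N ^ 2).natDegree < 2 * N.natDegree) {u : QuadraticAlgebra F[X] D 0}
    (hu : IsDominant N u) (hunit : IsUnit u) {B : ℕ} (hB : B ≤ N.natDegree)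
    (base : ∀ z : QuadraticAlgebra F[X] D 0, IsDominant N z → z.norm.natDegree < B →
      z.im.natDegree < u.im.natDegree → Associated z (star z))
    (z : QuadraticAlgebra F[X] D 0) (hz : z.norm.natDegree < B) : Associated z (star z) := by
  have hunorm : IsUnit u.norm := isUnit_iff_norm_isUnit.mp hunit
  have hu0 : u.norm.natDegree = 0 := Polynomial.natDegree_eq_zero_of_isUnit hunorm
  have hustar : IsUnit (star u) := hunit.star
  suffices ∀ k : ℕ, ∀ z : QuadraticAlgebra F[X] D 0, z.im.degree < k → z.norm.natDegree < B →
      Associated z (star z) from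
    this (z.im.natDegree + 1) z (Polynomial.degree_lt_cast_of_natDegree_lt (Nat.lt_succ_self _)) hz
  intro k
  induction k with
  | zero =>
    intro z hk _
    rw [Nat.cast_zero, Nat.WithBot.lt_zero_iff, Polynomial.degree_eq_bot] at hk
    have : star z = z := by ext <;> simp [hk]
    rw [this]
  | succ k ih =>
    have step : ∀ z : QuadraticAlgebra F[X] D 0, IsDominant N z → z.im.degree < (k + 1 : ℕ) →
        z.norm.natDegree < B → Associated z (star z) := by
      intro z hdom hk hzB
      rcases lt_or_ge z.im.natDegree u.im.natDegree with hlt | hge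
      · exact base z hdom hzB hlt
      -- Up to sign this difference is the `√D`-coefficient of `z * star u`, so dividing by the unit
      -- strictly lowers the degree.
      have hc := hdom.degree_re_mul_im_sub_lt h2 hN hu (t := z.im.natDegree) (by omega) (by omega)
      have him : (z * star u).im = -(z.re * u.im - z.im * u.re) := by
        simp [im_mul]; ring
      have hzk : z.im.natDegree ≤ k :=
        Nat.lt_succ_iff.mp ((Polynomial.natDegree_lt_iff_degree_lt hdom.1).mpr hk)
      have hassoc := ih (z * star u)
        (by rw [him, Polynomial.degree_neg]; exact hc.trans_le (Nat.cast_le.mpr hzk))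
        (by
          rw [map_mul, norm_star]
          refine (Polynomial.natDegree_mul_le).trans_lt ?_
          omega)
      rw [star_mul', star_star] at hassoc
      exact (associated_mul_isUnit_right_iff hustar).mpr (Associated.refl z) |>.trans
        (hassoc.trans (associated_mul_unit_left _ _ hunit))
    intro z hk hzB
    by_cases him : z.im = 0
    · have : star z = z := by ext <;> simp [him]
      rw [this]
    rcases isDominant_or_isDominant_star hD him (by omega) with hdom | hdom
    · exact step z hdom hk hzB
    · have := step (star z) hdom (by simpa using hk) (by simpa using hzB)
      rw [star_star] at this
      exact this.symm

end QuadraticAlgebra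

/-! ### The integral closure of `F[T]` in `k(√D)` is `F[T][√D]`. -/

theorem Polynomial.not_isSquare_of_squarefree {F : Type*} [Field F] {D : F[X]}
    (hD : Squarefree D) (hdeg : 0 < D.natDegree) : ¬ IsSquare D := by
  rintro ⟨f, rfl⟩
  have hf := hD f dvd_rfl
  rw [Polynomial.natDegree_eq_zero_of_isUnit (hf.mul hf)] at hdeg
  exact hdeg.false

theorem IsIntegrallyClosed.not_isSquare_algebraMap {R k : Type*} [CommRing R] [IsDomain R] [Field k] [Algebra R k]
    [IsFractionRing R k] [IsIntegrallyClosed R] {D : R} (hD : ¬ IsSquare D) :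
    ¬ IsSquare (algebraMap R k D) := by
  rintro ⟨f, hf⟩
  have hint : IsIntegral R f := by
    refine ⟨Polynomial.X ^ 2 - Polynomial.C D, Polynomial.monic_X_pow_sub_C D two_ne_zero, ?_⟩
    simp [hf, pow_two]
  obtain ⟨g, rfl⟩ := IsIntegrallyClosed.isIntegral_iff.mp hint
  refine hD ⟨g, IsFractionRing.injective R k ?_⟩
  simpa using hf

theorem exists_eq_add_mul_of_adjoin_eq_top {k K : Type*} [Field k] [Field K] [Algebra k K] {d : k} {s : K}
    (hs : s ^ 2 = algebraMap k K d) (htop : IntermediateField.adjoin k {s} = ⊤) (z : K) :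
    ∃ u v : k, z = algebraMap k K u + algebraMap k K v * s := by
  have hint : IsAlgebraic k s := by
    refine IsIntegral.isAlgebraic ⟨Polynomial.X ^ 2 - Polynomial.C d, Polynomial.monic_X_pow_sub_C d two_ne_zero, ?_⟩
    simp [hs]
  have hz : z ∈ Algebra.adjoin k {s} := by
    rw [← IntermediateField.adjoin_simple_toSubalgebra_of_isAlgebraic hint, htop]
    trivial
  induction hz using Algebra.adjoin_induction with
  | mem x hx => exact ⟨0, 1, by simpa using hx⟩
  | algebraMap r => exact ⟨r, 0, by simp⟩
  | add x y _ _ hx hy =>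
    obtain ⟨u, v, rfl⟩ := hx
    obtain ⟨u', v', rfl⟩ := hy
    exact ⟨u + u', v + v', by simp only [map_add]; ring⟩
  | mul x y _ _ hx hy =>
    obtain ⟨u, v, rfl⟩ := hx
    obtain ⟨u', v', rfl⟩ := hy
    refine ⟨u * u' + d * v * v', u * v' + v * u', ?_⟩
    simp only [map_add, map_mul, ← hs]; ring

section
variable {F K : Type*} [Field F] [Field K] [Algebra F[X] K] [Algebra (RatFunc F) K]
    [IsScalarTower F[X] (RatFunc F) K] {D : F[X]}

theorem IsAdjoinSqrt.functionField (hK : IsAdjoinSqrt F K D) : FunctionField F K := by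
  obtain ⟨s, hs, htop⟩ := hK
  have hint : IsIntegral (RatFunc F) s := by
    refine ⟨Polynomial.X ^ 2 - Polynomial.C (algebraMap F[X] _ D), Polynomial.monic_X_pow_sub_C _ two_ne_zero, ?_⟩
    simp [hs, ← IsScalarTower.algebraMap_apply]
  have := IntermediateField.adjoin.finiteDimensional hint
  rw [htop] at this
  exact Module.Finite.equiv (IntermediateField.topEquiv (F := RatFunc F) (E := K)).toLinearEquiv

theorem IsAdjoinSqrt.isSeparable (h2 : (2 : F) ≠ 0) (hD : D ≠ 0) (hK : IsAdjoinSqrt F K D) :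
    Algebra.IsSeparable (RatFunc F) K := by
  obtain ⟨s, hs, htop⟩ := hK
  have h2' : ((2 : ℕ) : RatFunc F) ≠ 0 := by
    have := (map_ne_zero (algebraMap F (RatFunc F))).mpr h2
    rw [map_ofNat] at this
    exact_mod_cast this
  have hD' : algebraMap F[X] (RatFunc F) D ≠ 0 := by
    simpa using hD
  have hsep : IsSeparable (RatFunc F) s := by
    refine (Polynomial.separable_X_pow_sub_C (n := 2) _ h2' hD').of_dvd (minpoly.dvd _ _ ?_)
    simp [hs, ← IsScalarTower.algebraMap_apply]
  have := (IntermediateField.isSeparable_adjoin_simple_iff_isSeparable (RatFunc F) K).mpr hsep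
  rw [htop] at this
  exact Algebra.IsSeparable.of_algHom (RatFunc F) _ (IntermediateField.topEquiv (F := RatFunc F) (E := K)).symm.toAlgHom

theorem exists_polynomial_of_squarefree_mul_sq {v : RatFunc F} {w : F[X]}
    (hD : Squarefree D) (h : algebraMap F[X] (RatFunc F) D * v ^ 2 = algebraMap F[X] (RatFunc F) w) :
    ∃ f, v = algebraMap F[X] (RatFunc F) f := by
  obtain ⟨f, g, hg, hfg, rfl⟩ : ∃ f g : F[X], g ≠ 0 ∧ IsCoprime f g ∧ v = algebraMap F[X] (RatFunc F) f / algebraMap F[X] (RatFunc F) g :=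
    ⟨v.num, v.denom, v.denom_ne_zero, v.isCoprime_num_denom, v.num_div_denom.symm⟩
  have hg' : algebraMap F[X] (RatFunc F) g ≠ 0 := by simpa using hg
  have h1 : D * f ^ 2 = w * g ^ 2 := by
    apply IsFractionRing.injective F[X] (RatFunc F)
    field_simp at h
    simp only [map_mul, map_pow]
    rw [h, mul_comm]
  have h2 : g * g ∣ D := by
    rw [← pow_two]
    have : g ^ 2 ∣ D * f ^ 2 := h1 ▸ dvd_mul_left _ _
    exact (hfg.symm.pow (m := 2) (n := 2)).dvd_of_dvd_mul_right this
  obtain ⟨g', hgg⟩ := (hD g h2).exists_right_inv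
  refine ⟨f * g', ?_⟩
  rw [div_eq_iff (by simpa using hg), map_mul, mul_assoc, ← map_mul, mul_comm g', hgg, map_one, mul_one]

/-- The trace `2 u` and the norm `u ^ 2 - D v ^ 2` are polynomials. Dividing by 2 gives `u`; then `D
v ^ 2` is a polynomial, and a denominator of `v` would have its square dividing `D`. -/
theorem exists_polynomial_of_isIntegral_add_mul_sqrt (h2 : (2 : F) ≠ 0) (hD : Squarefree D) (hdeg : 0 < D.natDegree) {s : K}
    (hs : s ^ 2 = algebraMap F[X] K D) {u v : RatFunc F} (hint : IsIntegral F[X] (algebraMap _ K u + algebraMap _ K v * s)) :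
    ∃ f g : F[X], u = algebraMap _ _ f ∧ v = algebraMap _ _ g := by
  have hs' : s ^ 2 = algebraMap (RatFunc F) K (algebraMap F[X] (RatFunc F) D) := by
    rw [hs, ← IsScalarTower.algebraMap_apply]
  have hnsq := IsIntegrallyClosed.not_isSquare_algebraMap (k := RatFunc F)
    (Polynomial.not_isSquare_of_squarefree hD hdeg)
  have hinj := (algebraMap (RatFunc F) K).injective
  by_cases hv : v = 0
  · subst hv
    simp only [map_zero, zero_mul, add_zero] at hint
    have : IsIntegral F[X] u := (isIntegral_algebraMap_iff hinj).mp hint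
    obtain ⟨f, hf⟩ := IsIntegrallyClosed.isIntegral_iff.mp this
    exact ⟨f, 0, hf.symm, by simp⟩
  have hmin : minpoly (RatFunc F) (algebraMap _ K u + algebraMap _ K v * s) =
      Polynomial.X ^ 2 - Polynomial.C (2 * u) * Polynomial.X +
        Polynomial.C (u ^ 2 - algebraMap F[X] (RatFunc F) D * v ^ 2) := by
    symm
    have hmon : (Polynomial.X ^ 2 - Polynomial.C (2 * u) * Polynomial.X +
        Polynomial.C (u ^ 2 - algebraMap F[X] (RatFunc F) D * v ^ 2)).Monic := by monicity!
    have hnd : (Polynomial.X ^ 2 - Polynomial.C (2 * u) * Polynomial.X +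
        Polynomial.C (u ^ 2 - algebraMap F[X] (RatFunc F) D * v ^ 2)).natDegree = 2 := by compute_degree!
    refine minpoly.eq_of_irreducible_of_monic ?_ ?_ hmon
    · rw [Polynomial.irreducible_iff_roots_eq_zero_of_degree_le_three (by rw [hnd]) (by rw [hnd]; norm_num)]
      by_contra hne
      obtain ⟨t, ht⟩ := Multiset.exists_mem_of_ne_zero hne
      have ht := Polynomial.isRoot_of_mem_roots ht
      simp only [Polynomial.IsRoot.def, Polynomial.eval_add, Polynomial.eval_sub, Polynomial.eval_mul, Polynomial.eval_pow,
        Polynomial.eval_C, Polynomial.eval_X] at ht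
      refine hnsq ⟨(t - u) / v, ?_⟩
      field_simp
      linear_combination -ht
    · simp only [map_add, map_sub, map_mul, map_pow, Polynomial.aeval_C, Polynomial.aeval_X, ← hs', map_ofNat]
      ring
  rw [minpoly.isIntegrallyClosed_eq_field_fractions' (RatFunc F) hint] at hmin
  have c1 := congrArg (Polynomial.coeff · 1) hmin
  have c0 := congrArg (Polynomial.coeff · 0) hmin
  simp only [Polynomial.coeff_map, Polynomial.coeff_add, Polynomial.coeff_sub, Polynomial.coeff_X_pow,
    Polynomial.coeff_C_mul, Polynomial.coeff_X_one, Polynomial.coeff_X_zero, Polynomial.coeff_C_zero,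
    Polynomial.coeff_C_of_ne_zero one_ne_zero] at c0 c1
  norm_num at c0 c1
  set P := minpoly F[X] (algebraMap _ K u + algebraMap _ K v * s)
  have hu : u = algebraMap F[X] (RatFunc F) (-Polynomial.C (2⁻¹ : F) * P.coeff 1) := by
    have h3 : algebraMap F[X] (RatFunc F) (Polynomial.C (2⁻¹ : F)) * 2 = 1 := by
      have : (Polynomial.C (2⁻¹ : F) : F[X]) * 2 = 1 := by
        rw [← Polynomial.C_ofNat, ← Polynomial.C_mul, inv_mul_cancel₀ h2, Polynomial.C_1]
      have := congrArg (algebraMap F[X] (RatFunc F)) this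
      rwa [map_mul, map_one, map_ofNat] at this
    rw [map_mul, map_neg, c1]
    linear_combination -u * h3
  obtain ⟨g, hg⟩ := exists_polynomial_of_squarefree_mul_sq (v := v)
    (w := (-Polynomial.C (2⁻¹ : F) * P.coeff 1) ^ 2 - P.coeff 0) hD (by
      rw [map_sub, map_pow, ← hu, c0]; ring)
  exact ⟨_, g, hu, hg⟩

theorem IsAdjoinSqrt.nonempty_ringEquiv (h2 : (2 : F) ≠ 0) (hD : Squarefree D) (hdeg : 0 < D.natDegree)
    (hK : IsAdjoinSqrt F K D) :
    Nonempty (QuadraticAlgebra F[X] D 0 ≃+* FunctionField.ringOfIntegers F K) := by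
  obtain ⟨s, hs, htop⟩ := hK
  have hs' : s ^ 2 = algebraMap (RatFunc F) K (algebraMap F[X] (RatFunc F) D) := by
    rw [hs, ← IsScalarTower.algebraMap_apply]
  have hnsq := IsIntegrallyClosed.not_isSquare_algebraMap (k := RatFunc F)
    (Polynomial.not_isSquare_of_squarefree hD hdeg)
  have hsint : IsIntegral F[X] s :=
    ⟨Polynomial.X ^ 2 - Polynomial.C D, Polynomial.monic_X_pow_sub_C D two_ne_zero, by simp [hs]⟩
  let φ : QuadraticAlgebra F[X] D 0 →ₐ[F[X]] K :=
    QuadraticAlgebra.lift ⟨s, by rw [← pow_two, hs, Algebra.smul_def]; simp⟩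
  have hφ (z) : φ z = algebraMap F[X] K z.re + algebraMap F[X] K z.im * s := by
    simp [φ, QuadraticAlgebra.lift, Algebra.smul_def]
  have hφinj : Function.Injective φ := by
    rw [injective_iff_map_eq_zero]
    intro z hz
    rw [hφ, IsScalarTower.algebraMap_apply F[X] (RatFunc F) K, IsScalarTower.algebraMap_apply F[X] (RatFunc F) K] at hz
    have him : z.im = 0 := by
      by_contra hne
      have hne' : algebraMap F[X] (RatFunc F) z.im ≠ 0 := by simpa using hne
      refine hnsq ⟨algebraMap F[X] (RatFunc F) z.re / algebraMap F[X] (RatFunc F) z.im, ?_⟩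
      field_simp
      apply (algebraMap (RatFunc F) K).injective
      rw [map_mul, map_pow, map_pow, ← hs']
      linear_combination (algebraMap (RatFunc F) K (algebraMap F[X] (RatFunc F) z.im) * s - algebraMap (RatFunc F) K (algebraMap F[X] (RatFunc F) z.re)) * hz
    have hre : z.re = 0 := by simpa [him] using hz
    ext <;> simp [him, hre]
  have hmem (z) : φ z ∈ integralClosure F[X] K := by
    rw [hφ]
    exact add_mem (algebraMap_mem _ _) (mul_mem (algebraMap_mem _ _) hsint)
  refine ⟨RingEquiv.ofBijective ((φ.codRestrict _ hmem).toRingHom) ⟨?_, ?_⟩⟩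
  · intro x y hxy
    exact hφinj (congrArg Subtype.val hxy)
  · rintro ⟨z, hz⟩
    obtain ⟨u, v, rfl⟩ := exists_eq_add_mul_of_adjoin_eq_top hs' htop z
    obtain ⟨f, g, rfl, rfl⟩ := exists_polynomial_of_isIntegral_add_mul_sqrt h2 hD hdeg hs hz
    refine ⟨⟨f, g⟩, Subtype.ext ?_⟩
    change φ _ = _
    simp only [hφ, ← IsScalarTower.algebraMap_apply]

end

/-! ### The order of the ideal class, and the elements of small norm. -/

namespace QuadraticAlgebra

variable {F : Type*} [Field F] {N D : F[X]}

theorem _root_.Polynomial.isCoprime_of_squarefree_sq_sub {U Z c : F[X]} {M : ℕ} (hM : 2 ≤ M)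
    (hD : Squarefree (U ^ 2 - c * Z ^ M)) : IsCoprime U Z := by
  have hdvd : ∀ p : F[X], p ∣ U → p ∣ Z → p * p ∣ U ^ 2 - c * Z ^ M := by
    intro p hU hZ
    rw [← pow_two]
    exact dvd_sub (pow_dvd_pow_of_dvd hU 2)
      (Dvd.dvd.mul_left ((pow_dvd_pow_of_dvd hZ 2).trans (pow_dvd_pow Z hM)) _)
  refine isCoprime_of_irreducible_dvd ?_ fun p hp hU hZ => hp.not_isUnit (hD p (hdvd p hU hZ))
  rintro ⟨rfl, rfl⟩
  exact not_isUnit_zero (hD 0 (hdvd 0 dvd_rfl dvd_rfl))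

/-- The ideal generated by `x` and its conjugate contains their sum `2 U` and their product `c Z ^
M`, which are coprime. -/
theorem isCoprime_mk_one_star (h2 : (2 : F) ≠ 0) {U Z : F[X]} {c : F} (hc : c ≠ 0) {M : ℕ}
    (hUZ : IsCoprime U Z) (hD : D = U ^ 2 - Polynomial.C c * Z ^ M) :
    IsCoprime (⟨U, 1⟩ : QuadraticAlgebra F[X] D 0) (star ⟨U, 1⟩) := by
  obtain ⟨a, b, hab⟩ := hUZ.pow_right (n := M)
  have h2' : (Polynomial.C (2⁻¹ : F) : F[X]) * 2 = 1 := by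
    rw [← Polynomial.C_ofNat, ← Polynomial.C_mul, inv_mul_cancel₀ h2, Polynomial.C_1]
  have hc' : (Polynomial.C c⁻¹ : F[X]) * Polynomial.C c = 1 := by
    rw [← Polynomial.C_mul, inv_mul_cancel₀ hc, Polynomial.C_1]
  refine ⟨algebraMap _ _ (Polynomial.C 2⁻¹ * a),
    algebraMap _ _ (Polynomial.C 2⁻¹ * a) + algebraMap _ _ (Polynomial.C c⁻¹ * b) * ⟨U, 1⟩, ?_⟩
  refine QuadraticAlgebra.ext ?_ ?_
  · simp only [algebraMap_eq, star_mk, re_add, re_mul, im_add, im_mul, re_one]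
    linear_combination hab + a * U * h2' + b * Z ^ M * hc' - Polynomial.C c⁻¹ * b * hD
  · simp only [algebraMap_eq, star_mk, re_add, re_mul, im_add, im_mul, im_one]
    ring

theorem exists_dvd_card_classGroup {O : Type*} [CommRing O] [IsDedekindDomain O]
    (e : QuadraticAlgebra F[X] D 0 ≃+* O) (h2 : (2 : F) ≠ 0) (hsq : Squarefree D) {U Z : F[X]} {c : F}
    (hc : c ≠ 0) {M : ℕ} (hM : 2 ≤ M) (hZ : 0 < Z.natDegree)
    (hD : D = U ^ 2 - Polynomial.C c * Z ^ M) {B : ℕ}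
    (hB : ∀ z : QuadraticAlgebra F[X] D 0, z.norm.natDegree < B → Associated z (star z)) :
    ∃ m, m ∣ M ∧ B ≤ m * Z.natDegree ∧ m ∣ Nat.card (ClassGroup O) := by
  have hcop := isCoprime_mk_one_star h2 hc
    (Polynomial.isCoprime_of_squarefree_sq_sub hM (hD ▸ hsq)) hD
  set x : QuadraticAlgebra F[X] D 0 := ⟨U, 1⟩ with hx
  have hZ0 : Z ≠ 0 := Polynomial.ne_zero_of_natDegree_gt hZ
  have hnorm : x.norm = Polynomial.C c * Z ^ M := by
    rw [norm_eq_sq_sub, hx]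
    linear_combination -hD
  have hnormdeg : x.norm.natDegree = M * Z.natDegree := by
    rw [hnorm, Polynomial.natDegree_C_mul hc, Polynomial.natDegree_pow]
  have hcunit : IsUnit (algebraMap F[X] (QuadraticAlgebra F[X] D 0) (Polynomial.C c)) :=
    ((Polynomial.isUnit_C.mpr hc.isUnit).map _)
  have hassoc : Associated (x * star x) (algebraMap F[X] (QuadraticAlgebra F[X] D 0) Z ^ M) := by
    rw [← algebraMap_norm_eq_mul_star, hnorm, map_mul, map_pow]
    exact (associated_isUnit_mul_left_iff hcunit).mpr (Associated.refl _)
  have hx0 : x ≠ 0 := fun h => one_ne_zero (congrArg QuadraticAlgebra.im h)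
  have hassoc' := hassoc.map e
  rw [map_mul, map_pow] at hassoc'
  obtain ⟨m, l, hml, hmcard, w, hw⟩ := ClassGroup.exists_dvd_card_of_mul_associated_pow (by omega)
    ((map_ne_zero_iff e e.injective).mpr hx0) (hcop.map e.toRingHom) hassoc'
  refine ⟨m, ⟨l, hml.symm⟩, ?_, hmcard⟩
  have hl : 0 < l := Nat.pos_of_ne_zero (by rintro rfl; omega)
  have hw' : Associated (e.symm w ^ l) x := by
    simpa using hw.map e.symm
  have hwnorm : Associated ((e.symm w).norm ^ l) x.norm := by
    simpa using hw'.map (norm (R := F[X]) (a := D) (b := 0))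
  have hwdeg : l * (e.symm w).norm.natDegree = M * Z.natDegree := by
    rw [← hnormdeg, ← Polynomial.natDegree_pow]
    exact Polynomial.natDegree_eq_of_degree_eq (Polynomial.degree_eq_degree_of_associated hwnorm)
  have hwdeg' : (e.symm w).norm.natDegree = m * Z.natDegree := by
    refine Nat.eq_of_mul_eq_mul_left hl ?_
    rw [hwdeg, ← hml]; ring
  -- Were the norm of `w` this small, `x` would be associated to its conjugate, hence a unit, while
  -- its norm is not constant.
  by_contra hlt
  have hstar := hB (e.symm w) (by omega)
  have hxstar : Associated x (star x) := by
    refine hw'.symm.trans ((hstar.pow_pow (n := l)).trans ?_)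
    have := hw'.map (starRingEnd (QuadraticAlgebra F[X] D 0))
    simpa [starRingEnd_apply] using this
  have hxunit : IsUnit x := hcop.isUnit_of_dvd' dvd_rfl hxstar.dvd
  have := Polynomial.natDegree_eq_zero_of_isUnit (isUnit_iff_norm_isUnit.mp hxunit)
  rw [hnormdeg] at this
  have : 0 < M * Z.natDegree := Nat.mul_pos (by omega) hZ
  omega

theorem associated_star_of_dvd_two_mul (h2 : (2 : F) ≠ 0) (hN : 0 < N.natDegree) {r s : F[X]}
    (hrs : r * s = 2 * N) (hD : D = N ^ 2 + r) (z : QuadraticAlgebra F[X] D 0)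
    (hz : z.norm.natDegree < N.natDegree) : Associated z (star z) := by
  have h2N : (2 : F[X]) * N ≠ 0 := by
    rw [← Polynomial.C_ofNat]
    exact mul_ne_zero (Polynomial.C_ne_zero.mpr h2) (Polynomial.ne_zero_of_natDegree_gt hN)
  have hr0 : r ≠ 0 := left_ne_zero_of_mul (hrs ▸ h2N)
  have hs0 : s ≠ 0 := right_ne_zero_of_mul (hrs ▸ h2N)
  have hdeg : r.natDegree + s.natDegree = N.natDegree := by
    rw [← Polynomial.natDegree_mul hr0 hs0, hrs, ← Polynomial.C_ofNat, Polynomial.natDegree_C_mul h2]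
  have hDN : (D - N ^ 2).natDegree < 2 * N.natDegree := by
    rw [hD, add_sub_cancel_left]; omega
  -- `u = w ^ 2 / r` for `w = N + √D`. As `w` has norm `-r`, this is a unit and carries the
  -- conjugate of `w` to `-w`.
  set u : QuadraticAlgebra F[X] D 0 := ⟨1 + s * N, s⟩ with hu
  set w : QuadraticAlgebra F[X] D 0 := ⟨N, 1⟩ with hw
  have hunit : IsUnit u := by
    rw [isUnit_iff_norm_isUnit, norm_eq_sq_sub]
    convert isUnit_one using 1
    linear_combination (-s ^ 2) * hD - s * hrs
  have hudom : IsDominant N u := by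
    refine ⟨hs0, Polynomial.degree_lt_cast_of_natDegree_lt ?_⟩
    rw [show u.re - N * u.im = 1 by rw [hu]; ring, Polynomial.natDegree_one]
    omega
  have hwdom : IsDominant N w := by
    refine ⟨one_ne_zero, Polynomial.degree_lt_cast_of_natDegree_lt ?_⟩
    rw [show w.re - N * w.im = 0 by rw [hw]; ring, Polynomial.natDegree_zero]
    omega
  have hwnorm : w.norm = -r := by
    rw [norm_eq_sq_sub, hw]
    linear_combination -hD
  have hwstar : Associated w (star w) := by
    have h : star w * u = -w := by
      refine QuadraticAlgebra.ext ?_ ?_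
      · simp only [hu, hw, star_mk, re_mul, re_neg]
        linear_combination -s * hD - hrs
      · simp only [hu, hw, star_mk, im_mul, im_neg]
        ring
    refine Associated.trans ?_ ((associated_mul_isUnit_right_iff hunit).mpr (Associated.refl _)).symm
    rw [h]
    exact (Associated.refl w).neg_right
  refine associated_star_of_natDegree_norm_lt h2 hN hDN hudom hunit le_rfl ?_ z hz
  intro z hz hzN hlt
  -- Below `u` the best approximation is `w` itself, so `z` is a polynomial multiple of `w` and
  -- inherits its behaviour under conjugation.
  have heq := hz.re_mul_im_eq h2 hN hwdom (by rw [hw, Polynomial.natDegree_one]; omega)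
    (by
      rw [hwnorm, Polynomial.natDegree_neg, hw, Polynomial.natDegree_one]
      change z.im.natDegree < s.natDegree at hlt
      omega)
  have hzw : z = algebraMap _ _ z.im * w := by
    refine QuadraticAlgebra.ext ?_ ?_
    · simp only [algebraMap_eq, re_mul]
      rw [hw] at heq ⊢
      linear_combination heq
    · simp only [algebraMap_eq, im_mul, hw]
      ring
  have hzw' : star z = algebraMap _ _ z.im * star w := by
    conv_lhs => rw [hzw, star_mul']
    congr 1
    ext <;> simp
  rw [hzw']
  conv_lhs => rw [hzw]
  exact hwstar.mul_left _

/-- With `β = N + √D` and `γ = β - τ`, the relation `γ β = 2 A ^ d β + κ A γ` yields one more factor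
`A` at each step, as long as `j ≤ d`. -/
theorem exists_smul_eq_mul_pow {A : F[X]} {κ τ : F} {d : ℕ}
    (h2N : 2 * N = 2 * A ^ d + Polynomial.C κ * A + Polynomial.C τ)
    (hD : D = N ^ 2 - Polynomial.C (κ * τ) * A) (j : ℕ) (hj : j ≤ d) :
    ∃ θ : QuadraticAlgebra F[X] D 0,
      A ^ j • θ = (⟨N - Polynomial.C τ, 1⟩ : QuadraticAlgebra F[X] D 0) * ⟨N, 1⟩ ^ j := by
  induction j with
  | zero => exact ⟨⟨N - Polynomial.C τ, 1⟩, by simp⟩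
  | succ j ih =>
    obtain ⟨θ, hθ⟩ := ih (by omega)
    refine ⟨(2 * A ^ (d - 1 - j)) • ⟨N, 1⟩ ^ (j + 1) + Polynomial.C κ • θ, ?_⟩
    have hpow : A ^ (j + 1) * (2 * A ^ (d - 1 - j)) = 2 * A ^ d := by
      rw [mul_left_comm, ← pow_add]
      congr 3
      omega
    have hquad : (2 * A ^ d) • (⟨N, 1⟩ : QuadraticAlgebra F[X] D 0) +
        (Polynomial.C κ * A) • ⟨N - Polynomial.C τ, 1⟩ =
        (⟨N - Polynomial.C τ, 1⟩ : QuadraticAlgebra F[X] D 0) * ⟨N, 1⟩ := by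
      rw [Polynomial.C_mul] at hD
      refine QuadraticAlgebra.ext ?_ ?_
      · simp only [re_add, re_smul, re_mul, smul_eq_mul]
        linear_combination -hD - N * h2N
      · simp only [im_add, im_smul, im_mul, smul_eq_mul]
        linear_combination -h2N
    rw [smul_add, smul_smul, hpow, smul_smul, show A ^ (j + 1) * Polynomial.C κ =
      (Polynomial.C κ * A) * A ^ j by ring, mul_smul (Polynomial.C κ * A), hθ, pow_succ', ← mul_assoc, ← hquad, add_mul,
      smul_mul_assoc, smul_mul_assoc]

/-- The powers `β ^ j` have norm of degree `j deg A`, and `θ_j = γ β ^ j / A ^ j` has norm of degree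
`(d - j) deg A`, so `θ_d` is a unit. Below that unit, a dominant element of norm degree less than
`deg A` would be proportional to some `β ^ j` with `j ≥ 1` or some `θ_j` with `j < d`, whose norms
have degree at least `deg A`. So the base of the descent is vacuous. -/
theorem associated_star_of_natDegree_norm_lt_natDegree (h2 : (2 : F) ≠ 0) {A : F[X]} {κ τ : F}
    (hκ : κ ≠ 0) (hτ : τ ≠ 0) {d : ℕ} (hd : 1 ≤ d) (hA : 0 < A.natDegree)
    (hNdeg : N.natDegree = d * A.natDegree)
    (h2N : 2 * N = 2 * A ^ d + Polynomial.C κ * A + Polynomial.C τ)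
    (hD : D = N ^ 2 - Polynomial.C (κ * τ) * A) (z : QuadraticAlgebra F[X] D 0)
    (hz : z.norm.natDegree < A.natDegree) : Associated z (star z) := by
  have hA0 : A ≠ 0 := Polynomial.ne_zero_of_natDegree_gt hA
  have hAN : A.natDegree ≤ N.natDegree := hNdeg ▸ Nat.le_mul_of_pos_left _ hd
  have hN : 0 < N.natDegree := hA.trans_le hAN
  have hκτ : κ * τ ≠ 0 := mul_ne_zero hκ hτ
  have h2τ : 2 * τ ≠ 0 := mul_ne_zero h2 hτ
  have hDN : (D - N ^ 2).natDegree < 2 * N.natDegree := by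
    rw [hD, sub_sub_cancel_left, Polynomial.natDegree_neg, Polynomial.natDegree_C_mul hκτ]; omega
  set β : QuadraticAlgebra F[X] D 0 := ⟨N, 1⟩ with hβ
  set γ : QuadraticAlgebra F[X] D 0 := ⟨N - Polynomial.C τ, 1⟩ with hγ
  have hβdom : IsDominant N β := by
    refine ⟨one_ne_zero, Polynomial.degree_lt_cast_of_natDegree_lt ?_⟩
    rw [show β.re - N * β.im = 0 by rw [hβ]; ring, Polynomial.natDegree_zero]
    omega
  have hγdom : IsDominant N γ := by
    refine ⟨one_ne_zero, Polynomial.degree_lt_cast_of_natDegree_lt ?_⟩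
    rw [show γ.re - N * γ.im = -Polynomial.C τ by rw [hγ]; ring, Polynomial.natDegree_neg,
      Polynomial.natDegree_C]
    omega
  have hβim : β.im.natDegree = 0 := Polynomial.natDegree_one
  have hγim : γ.im.natDegree = 0 := Polynomial.natDegree_one
  have hβnorm : β.norm = Polynomial.C (κ * τ) * A := by
    rw [norm_eq_sq_sub, hβ]
    linear_combination -hD
  have hγnorm : γ.norm = Polynomial.C (-(2 * τ)) * A ^ d := by
    rw [norm_eq_sq_sub, hγ]
    simp only [Polynomial.C_mul, Polynomial.C_neg, Polynomial.C_ofNat] at hD ⊢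
    linear_combination -hD - Polynomial.C τ * h2N
  have hβpow (j : ℕ) : IsDominant N (β ^ (j + 1)) ∧ (β ^ (j + 1)).im.natDegree = j * N.natDegree := by
    have := hβdom.pow_succ h2 hN hDN j
    rwa [hβim, mul_zero, add_zero] at this
  have hβpow0 (j : ℕ) : (β ^ j).norm ≠ 0 := by
    rw [map_pow, hβnorm]
    exact pow_ne_zero _ (mul_ne_zero (Polynomial.C_ne_zero.mpr hκτ) hA0)
  have hβpownorm (j : ℕ) : (β ^ j).norm.natDegree = j * A.natDegree := by
    rw [map_pow, hβnorm, Polynomial.natDegree_pow, Polynomial.natDegree_C_mul hκτ]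
  have hγ0 : γ.norm ≠ 0 := by
    rw [hγnorm]
    exact mul_ne_zero (Polynomial.C_ne_zero.mpr (neg_ne_zero.mpr h2τ)) (pow_ne_zero _ hA0)
  have hθ (j : ℕ) (hj : j < d) : ∃ θ : QuadraticAlgebra F[X] D 0, IsDominant N θ ∧
      (j + 1) * A.natDegree + θ.im.natDegree = (j + 1) * N.natDegree ∧ θ.norm ≠ 0 ∧
      (j + 1) * A.natDegree + θ.norm.natDegree = d * A.natDegree := by
    obtain ⟨θ, hθ⟩ := exists_smul_eq_mul_pow h2N hD (j + 1) hj
    rw [← hγ, ← hβ] at hθ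
    have hdom : IsDominant N (A ^ (j + 1) • θ) := hθ ▸ hγdom.mul h2 hN hDN (hβpow j).1
    obtain ⟨h1, h3⟩ := hdom.of_smul (pow_ne_zero _ hA0)
    rw [Polynomial.natDegree_pow, hθ, hγdom.natDegree_im_mul h2 hN (hβpow j).1, (hβpow j).2, hγim] at h3
    have hnorm : (A ^ (j + 1)) ^ 2 * θ.norm = γ.norm * (β ^ (j + 1)).norm := by
      rw [← map_mul, ← hθ, norm_eq_sq_sub, norm_eq_sq_sub]
      simp only [re_smul, im_smul, smul_eq_mul]
      ring
    have hθ0 : θ.norm ≠ 0 := by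
      have h : (A ^ (j + 1)) ^ 2 * θ.norm ≠ 0 := by
        rw [hnorm]
        exact mul_ne_zero hγ0 (hβpow0 _)
      exact right_ne_zero_of_mul h
    have hnd := congrArg Polynomial.natDegree hnorm
    rw [Polynomial.natDegree_mul (pow_ne_zero _ (pow_ne_zero _ hA0)) hθ0, Polynomial.natDegree_mul hγ0 (hβpow0 _), hβpownorm,
      hγnorm, Polynomial.natDegree_C_mul (neg_ne_zero.mpr h2τ), Polynomial.natDegree_pow,
      Polynomial.natDegree_pow, Polynomial.natDegree_pow] at hnd
    refine ⟨θ, h1, ?_, hθ0, ?_⟩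
    · rw [← h3]; ring
    · linarith
  obtain ⟨u, hudom, huim, hu0, hunorm⟩ := hθ (d - 1) (by omega)
  rw [Nat.sub_add_cancel hd] at huim hunorm
  have hunit : IsUnit u := by
    rw [isUnit_iff_norm_isUnit, Polynomial.isUnit_iff_degree_eq_zero, Polynomial.degree_eq_natDegree hu0]
    norm_cast
    omega
  refine associated_star_of_natDegree_norm_lt h2 hN hDN hudom hunit hAN ?_ z hz
  intro z hzdom hzA hlt
  exfalso
  -- The `√D`-coefficients of `β ^ (j + 1)`, `θ_(j + 1)` and `β ^ (j + 2)` have degrees `j deg N`,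
  -- `(j + 1)(deg N - deg A)` and `(j + 1) deg N`. The first element handles `z` up to the middle
  -- degree, the second from there on.
  set j := z.im.natDegree / N.natDegree with hj
  have hj1 : j * N.natDegree ≤ z.im.natDegree := Nat.div_mul_le_self _ _
  have hj2 : z.im.natDegree < (j + 1) * N.natDegree := by
    rw [mul_comm]; exact Nat.lt_mul_div_succ _ hN
  have hjd : j + 1 < d := by
    by_contra hcon
    have h3 : d * N.natDegree ≤ (j + 1) * N.natDegree := Nat.mul_le_mul_right _ (by omega)
    have h4 : (j + 1) * N.natDegree = j * N.natDegree + N.natDegree := by ring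
    omega
  have hjA : A.natDegree ≤ (j + 1) * A.natDegree := Nat.le_mul_of_pos_left _ (Nat.succ_pos j)
  have hdA : (j + 1) * A.natDegree + A.natDegree ≤ d * A.natDegree := by
    rw [← Nat.succ_mul]
    exact Nat.mul_le_mul_right _ hjd
  have hj4 : (j + 1) * N.natDegree = j * N.natDegree + N.natDegree := by ring
  obtain ⟨θ, hθdom, hθim, hθ0, hθnorm⟩ := hθ j (by omega)
  rcases lt_or_ge z.im.natDegree θ.im.natDegree with h | h
  · have := hzdom.natDegree_norm_le h2 hN (hβpow j).1 (hβpow0 _) (by omega) (by rw [(hβpow j).2]; exact hj1)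
      (by rw [hβpownorm, (hβpow j).2]; omega)
    rw [hβpownorm] at this
    omega
  · have := hzdom.natDegree_norm_le h2 hN hθdom hθ0 (by omega) h (by omega)
    omega

end QuadraticAlgebra

/-! ### The nine series satisfy the criterion. -/

theorem Polynomial.not_squarefree_pow_two {F : Type*} [Field F] {N : F[X]} (hN : 0 < N.natDegree) :
    ¬ Squarefree (N ^ 2) := fun h =>
  hN.ne' (Polynomial.natDegree_eq_zero_of_isUnit (h N (pow_two N ▸ dvd_rfl)))

theorem Polynomial.two_eq_zero {F : Type*} [Field F] (h2 : (2 : F) = 0) : (2 : F[X]) = 0 := by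
  rw [← Polynomial.C_ofNat, h2, Polynomial.C_0]

section
variable {F : Type*} [Field F] {n : ℕ} {D : F[X]}

/-- In characteristic 2 each of these `D` is the square of a non-constant polynomial. -/
theorem FirstFamily.two_ne_zero (hn : 1 ≤ n) (hD : Squarefree D) (h : FirstFamily n D) :
    (2 : F) ≠ 0 := by
  intro h2
  have h2' := Polynomial.two_eq_zero h2
  have h4' : (4 : F[X]) = 0 := by linear_combination 2 * h2'
  cases h with
  | series1 Z hZ =>
    refine Polynomial.not_squarefree_pow_two (N := Z ^ n + 1) ?_ ?_
    · rw [← Polynomial.C_1, Polynomial.natDegree_add_C, Polynomial.natDegree_pow]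
      exact Nat.mul_pos hn hZ
    · convert hD using 1
      linear_combination Z ^ n * h2'
  | series2 Z F hZ hF hN => exact Polynomial.not_squarefree_pow_two hN (by simpa [h4'] using hD)
  | series3 Z F hZ hF hN => exact Polynomial.not_squarefree_pow_two hN (by simpa [h4'] using hD)
  | series4 Z F hZ hF hN =>
    -- The coefficient 4 also occurs inside the square, so it is restored there at the end.
    exact Polynomial.not_squarefree_pow_two hN (by rwa [h4', zero_mul F, add_zero, ← h4'] at hD)
  | general Z F a b hZ ha hb hF hN =>
    exact Polynomial.not_squarefree_pow_two hN (by simpa [h4'] using hD)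

theorem SecondData.two_ne_zero (hn : 1 ≤ n) {a A Z : F[X]} (h : SecondData n a A Z) :
    (2 : F) ≠ 0 := by
  intro h2
  have hA := h.A_eq
  rw [Polynomial.two_eq_zero h2, zero_mul, zero_add, h.A_eq_pow] at hA
  have hdeg := congrArg Polynomial.natDegree hA
  rw [Polynomial.natDegree_pow, Polynomial.natDegree_one] at hdeg
  exact (Nat.mul_pos hn h.Z_nonconst).ne' hdeg

theorem SecondFamily.two_ne_zero (hn : 1 ≤ n) (h : SecondFamily n D) : (2 : F) ≠ 0 := by
  cases h <;> exact SecondData.two_ne_zero hn ‹_›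

/-- `D = U ^ 2 - c Z ^ M` with `M = n` or `M = 2 n`, and the elements of `F[T][√D]` whose norm has
degree less than that of `Z ^ n` generate ideals stable under conjugation. -/
def HasPowerNorm (n : ℕ) (D : F[X]) : Prop :=
  0 < D.natDegree ∧ ∃ (U Z : F[X]) (c : F) (M : ℕ), c ≠ 0 ∧ 0 < Z.natDegree ∧
    (M = n ∨ M = 2 * n) ∧ D = U ^ 2 - Polynomial.C c * Z ^ M ∧
    ∀ z : QuadraticAlgebra F[X] D 0, z.norm.natDegree < n * Z.natDegree → Associated z (star z)

/-- From `m ≥ n` and `m l = M ≤ 2 n` follows `l ≤ 2`, so `m` can only be `n` or `2 n`. -/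
theorem HasPowerNorm.dvd_card {O : Type*} [CommRing O] [IsDedekindDomain O] (h : HasPowerNorm n D)
    (e : QuadraticAlgebra F[X] D 0 ≃+* O) (h2 : (2 : F) ≠ 0) (hD : Squarefree D) (hn : 2 ≤ n) :
    n ∣ Nat.card (ClassGroup O) := by
  obtain ⟨-, U, Z, c, M, hc, hZ, hM, hDU, hB⟩ := h
  obtain ⟨m, ⟨l, hml⟩, hle, hcard⟩ :=
    QuadraticAlgebra.exists_dvd_card_classGroup e h2 hD hc (by omega) hZ hDU hB
  have hnm : n ≤ m := Nat.le_of_mul_le_mul_right hle hZ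
  refine dvd_trans ?_ hcard
  have hl : l ≠ 0 := by rintro rfl; omega
  have hl3 : l < 3 := by
    by_contra hcon
    have : m * 3 ≤ m * l := Nat.mul_le_mul_left _ (by omega)
    omega
  interval_cases l
  · omega
  · rcases hM with hM | hM
    · exact ⟨1, by omega⟩
    · exact ⟨2, by omega⟩
  · exact ⟨1, by omega⟩

theorem HasPowerNorm.of_dvd_two_mul (h2 : (2 : F) ≠ 0) {N r s U Z : F[X]} {c : F} {M : ℕ}
    (hN : 0 < N.natDegree) (hrs : r * s = 2 * N) (hNZ : N.natDegree = n * Z.natDegree) (hc : c ≠ 0)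
    (hZ : 0 < Z.natDegree) (hM : M = n ∨ M = 2 * n) (hD : D = N ^ 2 + r)
    (hU : D = U ^ 2 - Polynomial.C c * Z ^ M) : HasPowerNorm n D := by
  refine ⟨?_, U, Z, c, M, hc, hZ, hM, hU, fun z hz =>
    QuadraticAlgebra.associated_star_of_dvd_two_mul h2 hN hrs hD z (hNZ ▸ hz)⟩
  have h2N : (2 : F[X]) * N ≠ 0 := by
    rw [← Polynomial.C_ofNat]
    exact mul_ne_zero (Polynomial.C_ne_zero.mpr h2) (Polynomial.ne_zero_of_natDegree_gt hN)
  have hr := Polynomial.natDegree_le_of_dvd ⟨s, hrs.symm⟩ h2N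
  rw [← Polynomial.C_ofNat, Polynomial.natDegree_C_mul h2] at hr
  rw [hD, Polynomial.natDegree_add_eq_left_of_natDegree_lt] <;> rw [Polynomial.natDegree_pow] <;> omega

/-- Writing `e Z ^ n - b = G H` gives `N = G (H + a)`, so `r = 4 a b G` divides `2 N`. Completing
the square differently, with `U = N + 2 b`, gives `D = U ^ 2 - 4 b e Z ^ n`. -/
theorem HasPowerNorm.of_dvd_sub (hn : 1 ≤ n) (h2 : (2 : F) ≠ 0) {Z G : F[X]} {e a b : F} (he : e ≠ 0)
    (ha : a ≠ 0) (hb : b ≠ 0) (hZ : 0 < Z.natDegree)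
    (hG : G ∣ Polynomial.C e * Z ^ n - Polynomial.C b)
    (hN : 0 < (Polynomial.C e * Z ^ n + Polynomial.C a * G - Polynomial.C b).natDegree)
    (hD : D = (Polynomial.C e * Z ^ n + Polynomial.C a * G - Polynomial.C b) ^ 2 +
      4 * Polynomial.C a * Polynomial.C b * G) : HasPowerNorm n D := by
  obtain ⟨H, hH⟩ := hG
  have hNG : Polynomial.C e * Z ^ n + Polynomial.C a * G - Polynomial.C b =
      G * (H + Polynomial.C a) := by linear_combination hH
  have h4b : 4 * b * e ≠ 0 := by
    refine mul_ne_zero (mul_ne_zero ?_ hb) he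
    convert mul_ne_zero h2 h2 using 1
    norm_num
  have h2ab : (Polynomial.C (2 * a * b)⁻¹ : F[X]) * (2 * Polynomial.C a * Polynomial.C b) = 1 := by
    rw [← Polynomial.C_ofNat, ← Polynomial.C_mul, ← Polynomial.C_mul, ← Polynomial.C_mul,
      inv_mul_cancel₀ (mul_ne_zero (mul_ne_zero h2 ha) hb), Polynomial.C_1]
  refine HasPowerNorm.of_dvd_two_mul h2 hN (r := 4 * Polynomial.C a * Polynomial.C b * G)
    (s := Polynomial.C (2 * a * b)⁻¹ * (H + Polynomial.C a))
    (U := Polynomial.C e * Z ^ n + Polynomial.C a * G + Polynomial.C b) (Z := Z) (c := 4 * b * e) (M := n)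
    ?_ ?_ h4b hZ (Or.inl rfl) hD ?_
  · rw [hNG]
    linear_combination 2 * G * (H + Polynomial.C a) * h2ab
  · have hN0 := Polynomial.ne_zero_of_natDegree_gt hN
    rw [hNG] at hN0 hN ⊢
    have hZn : (Polynomial.C e * Z ^ n - Polynomial.C b).natDegree = n * Z.natDegree := by
      rw [Polynomial.natDegree_sub_C, Polynomial.natDegree_C_mul he, Polynomial.natDegree_pow]
    rw [← hZn, Polynomial.natDegree_mul (left_ne_zero_of_mul hN0) (right_ne_zero_of_mul hN0),
      Polynomial.natDegree_add_C, hH]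
    rcases eq_or_ne H 0 with rfl | hH0
    · exfalso
      rw [mul_zero] at hH
      rw [hH, Polynomial.natDegree_zero] at hZn
      exact (Nat.mul_pos hn hZ).ne hZn
    · rw [Polynomial.natDegree_mul (left_ne_zero_of_mul hN0) hH0]
  · rw [hD]
    simp only [Polynomial.C_mul, Polynomial.C_ofNat]
    ring

theorem FirstFamily.hasPowerNorm (hn : 1 ≤ n) (hD : Squarefree D) (h : FirstFamily n D) :
    HasPowerNorm n D := by
  have h2 := h.two_ne_zero hn hD
  have h4 : (4 : F) ≠ 0 := by
    convert mul_ne_zero h2 h2 using 1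
    norm_num
  cases h with
  | series1 Z hZ =>
    have hdeg : (Z ^ n).natDegree = n * Z.natDegree := Polynomial.natDegree_pow _ _
    -- The only series with `M = 2 n`: the element `1 + √D` has norm `-Z ^ (2 n)`.
    refine HasPowerNorm.of_dvd_two_mul h2 (N := Z ^ n) (r := 1) (s := 2 * Z ^ n) (U := 1) (Z := Z)
      (c := -1) (M := 2 * n) ?_ (one_mul _) hdeg (neg_ne_zero.mpr one_ne_zero) hZ (Or.inr rfl) ?_ ?_
    · rw [hdeg]
      exact Nat.mul_pos hn hZ
    · ring
    · simp only [Polynomial.C_neg, Polynomial.C_1]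
      ring
  | series2 Z G hZ hG hN =>
    refine HasPowerNorm.of_dvd_sub hn h2 (Z := Z) (G := G) (e := 1) (a := 1) (b := 1) one_ne_zero
      one_ne_zero one_ne_zero hZ ?_ ?_ ?_ <;>
    simp only [Polynomial.C_1, one_mul, mul_one] <;>
    assumption
  | series3 Z G hZ hG hN =>
    refine HasPowerNorm.of_dvd_sub hn h2 (Z := Z) (G := G) (e := 1) (a := -1) (b := -1) one_ne_zero
      (neg_ne_zero.mpr one_ne_zero) (neg_ne_zero.mpr one_ne_zero) hZ ?_ ?_ ?_ <;>
    simp only [Polynomial.C_neg, Polynomial.C_1, one_mul, neg_mul, mul_one, mul_neg, neg_neg,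
      sub_neg_eq_add, ← sub_eq_add_neg] <;>
    assumption
  | series4 Z G hZ hG hN =>
    refine HasPowerNorm.of_dvd_sub hn h2 (Z := Z) (G := G) (e := 4) (a := 1) (b := 1) h4
      one_ne_zero one_ne_zero hZ ?_ ?_ ?_ <;>
    simp only [Polynomial.C_ofNat, Polynomial.C_1, one_mul, mul_one] <;>
    assumption
  | general Z G a b hZ ha hb hG hN =>
    refine HasPowerNorm.of_dvd_sub hn h2 (Z := Z) (G := G) (e := 1) one_ne_zero ha hb hZ ?_ ?_ ?_ <;>
    simp only [Polynomial.C_1, one_mul] <;>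
    assumption

/-- Only for `d = 1` do the terms `2 A ^ d` and `κ A` compete; with `κ = 1` they cancel exactly in
characteristic 3. -/
theorem Polynomial.natDegree_of_two_mul_eq (h2 : (2 : F) ≠ 0) {N A : F[X]} {κ τ : F} {d : ℕ}
    (hd : 1 ≤ d) (hA : 0 < A.natDegree) (hκ : d = 1 → 2 + κ ≠ 0)
    (h2N : 2 * N = 2 * A ^ d + Polynomial.C κ * A + Polynomial.C τ) :
    N.natDegree = d * A.natDegree := by
  rw [← Polynomial.natDegree_C_mul h2, Polynomial.C_ofNat, h2N, Polynomial.natDegree_add_C]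
  rcases eq_or_ne d 1 with rfl | hd1
  · rw [pow_one, ← add_mul, ← Polynomial.C_ofNat, ← Polynomial.C_add,
      Polynomial.natDegree_C_mul (hκ rfl), one_mul]
  · have hlt : A.natDegree < d * A.natDegree := (Nat.lt_mul_iff_one_lt_left hA).mpr (by omega)
    have hdeg : (2 * A ^ d).natDegree = d * A.natDegree := by
      rw [← Polynomial.C_ofNat, Polynomial.natDegree_C_mul h2, Polynomial.natDegree_pow]
    rw [Polynomial.natDegree_add_eq_left_of_natDegree_lt, hdeg]
    rw [hdeg]
    exact (Polynomial.natDegree_C_mul_le _ _).trans_lt hlt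

theorem HasPowerNorm.of_two_mul_eq (hn : 1 ≤ n) (h2 : (2 : F) ≠ 0) {N A Z : F[X]} {κ τ : F}
    (hκ : κ ≠ 0) (hτ : τ ≠ 0) {d : ℕ} (hd : 1 ≤ d) (hZ : 0 < Z.natDegree) (hA : A = Z ^ n)
    (hκ2 : d = 1 → 2 + κ ≠ 0)
    (h2N : 2 * N = 2 * A ^ d + Polynomial.C κ * A + Polynomial.C τ)
    (hD : D = N ^ 2 - Polynomial.C (κ * τ) * A) : HasPowerNorm n D := by
  have hAdeg : A.natDegree = n * Z.natDegree := by rw [hA, Polynomial.natDegree_pow]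
  have hA0 : 0 < A.natDegree := hAdeg ▸ Nat.mul_pos hn hZ
  have hNdeg := Polynomial.natDegree_of_two_mul_eq h2 hd hA0 hκ2 h2N
  have hAN : A.natDegree ≤ N.natDegree := hNdeg ▸ Nat.le_mul_of_pos_left _ hd
  have hκτ := mul_ne_zero hκ hτ
  refine ⟨?_, N, Z, κ * τ, n, hκτ, hZ, Or.inl rfl, hA ▸ hD, fun z hz =>
    QuadraticAlgebra.associated_star_of_natDegree_norm_lt_natDegree h2 hκ hτ hd hA0 hNdeg h2N hD z
      (hAdeg ▸ hz)⟩
  rw [hD, Polynomial.natDegree_sub_eq_left_of_natDegree_lt] <;> rw [Polynomial.natDegree_pow]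
  · omega
  · rw [Polynomial.natDegree_C_mul hκτ]
    omega

theorem two_add_one_ne_zero_of_natDegree_pos (h2 : (2 : F) ≠ 0) {N A : F[X]} {τ : F}
    (hN : 0 < N.natDegree) (h2N : 2 * N = 2 * A + A + Polynomial.C τ) : (2 : F) + 1 ≠ 0 := by
  intro h3
  have h3' : (2 : F[X]) + 1 = 0 := by
    rw [← Polynomial.C_ofNat, ← Polynomial.C_1, ← Polynomial.C_add, h3, Polynomial.C_0]
  have : Polynomial.C 2 * N = Polynomial.C τ := by
    rw [Polynomial.C_ofNat]
    linear_combination h2N + A * h3'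
  rw [← Polynomial.natDegree_C_mul h2, this, Polynomial.natDegree_C] at hN
  exact hN.false

theorem SecondFamily.hasPowerNorm (hn : 1 ≤ n) (h : SecondFamily n D) : HasPowerNorm n D := by
  have h2 := h.two_ne_zero hn
  have hm1 : (-1 : F) ≠ 0 := neg_ne_zero.mpr one_ne_zero
  have h21 : (2 : F) + -1 ≠ 0 := by
    rw [show (2 : F) + -1 = 1 by norm_num]
    exact one_ne_zero
  cases h with
  | series1 a A Z d h hd hN =>
    refine HasPowerNorm.of_two_mul_eq hn h2 (N := A ^ d + a) (κ := 1) (τ := -1) one_ne_zero hm1 hd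
      h.Z_nonconst h.A_eq_pow ?_ ?_ ?_
    · rintro rfl
      refine two_add_one_ne_zero_of_natDegree_pos h2 (A := A) (τ := -1) hN ?_
      simp only [Polynomial.C_neg, Polynomial.C_1]
      linear_combination -h.A_eq
    · simp only [Polynomial.C_neg, Polynomial.C_1]
      linear_combination -h.A_eq
    · simp only [one_mul, Polynomial.C_neg, Polynomial.C_1]
      ring
  | series2 a A Z d h hd =>
    refine HasPowerNorm.of_two_mul_eq hn h2 (N := A ^ d - a) (κ := -1) (τ := 1) hm1 one_ne_zero hd
      h.Z_nonconst h.A_eq_pow (fun _ => h21) ?_ ?_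
    · simp only [Polynomial.C_neg, Polynomial.C_1]
      linear_combination h.A_eq
    · simp only [mul_one, Polynomial.C_neg, Polynomial.C_1]
      ring
  | series3 a A Z d h hd hN =>
    refine HasPowerNorm.of_two_mul_eq hn h2 (N := A ^ d + a + 1) (κ := 1) (τ := 1) one_ne_zero
      one_ne_zero hd h.Z_nonconst h.A_eq_pow ?_ ?_ ?_
    · rintro rfl
      refine two_add_one_ne_zero_of_natDegree_pos h2 (A := A) (τ := 1) hN ?_
      simp only [Polynomial.C_1]
      linear_combination -h.A_eq
    · simp only [Polynomial.C_1]
      linear_combination -h.A_eq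
    · simp only [mul_one, Polynomial.C_1]
      ring
  | series4 a A Z d h hd =>
    refine HasPowerNorm.of_two_mul_eq hn h2 (N := A ^ d - a - 1) (κ := -1) (τ := -1) hm1 hm1 hd
      h.Z_nonconst h.A_eq_pow (fun _ => h21) ?_ ?_
    · simp only [Polynomial.C_neg, Polynomial.C_1]
      linear_combination h.A_eq
    · simp only [neg_mul_neg, mul_one, Polynomial.C_1]
      ring

end

theorem mainTheorem4 (Fq : Type*) [Field Fq] [Finite Fq]
    (K : Type*) [Field K] [Algebra Fq[X] K] [Algebra (RatFunc Fq) K]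
    [IsScalarTower Fq[X] (RatFunc Fq) K]
    (n : ℕ) (hn : 1 ≤ n) (D : Fq[X]) (hD : Squarefree D)
    (hfam : FirstFamily n D ∨ SecondFamily n D)
    (hK : IsAdjoinSqrt Fq K D) :
    Finite (ClassGroup (FunctionField.ringOfIntegers Fq K)) ∧
      n ∣ idealClassNumber Fq K ∧ n ≤ idealClassNumber Fq K := by
  have h2 : (2 : Fq) ≠ 0 := hfam.elim (·.two_ne_zero hn hD) (·.two_ne_zero hn)
  have hpow : HasPowerNorm n D := hfam.elim (·.hasPowerNorm hn hD) (·.hasPowerNorm hn)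
  have := hK.functionField
  have := hK.isSeparable h2 hD.ne_zero
  have := Fintype.ofFinite Fq
  -- Finiteness rests on the finite constant field and the separability of `K` over `k`.
  have hfin : Finite (ClassGroup (FunctionField.ringOfIntegers Fq K)) := inferInstance
  obtain ⟨e⟩ := hK.nonempty_ringEquiv h2 hD hpow.1
  have hdvd : n ∣ idealClassNumber Fq K := by
    -- The coprimality of `x` and its conjugate needs exponent at least 2, so `n = 1` is set apart.
    rcases hn.eq_or_lt with rfl | hn2
    · exact one_dvd _
    · exact hpow.dvd_card e h2 hD hn2
  exact ⟨hfin, hdvd, Nat.le_of_dvd Nat.card_pos hdvd⟩
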